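/- **Proposition.** Let $\alpha$ be an algebraic number with primitive minimal polynomial $A(X)=a_nX^n+\cdots+a_1X+a_0\in\mathbb Z[X]$ (integer coefficients with $\gcd 1$, $n=[\mathbb{Q}(\alpha):\mathbb Q]$, sign of $A$ arbitrary), and assume that $\alpha$ is expanding, i.e. every complex root of $A$ has modulus greater than $1$. Let $K=\mathbb Q(\alpha)$ have $r_1$ real embeddings and $r_2$ pairs of complex embeddings and let $\mathcal O$ be its ring of integers. Write $\alpha\mathcal O=\mathfrak a/\mathfrak b$ with coprime ideals $\mathfrak a,\mathfrak b$ of $\mathcal O$. Put $\mathbb K_\infty=\mathbb R^{r_1}\times\mathbb C^{r_2}$ and $\mathbb K_\alpha=\mathbb K_\infty\times\prod_{\mathfrak p\mid\mathfrak b}K_{\mathfrak p}$, where $K_{\mathfrak p}$ is the $\mathfrak p$-adic completion of $K$, and let $\Phi_\infty:K\to\mathbb K_\infty$, $\Phi_\alpha:K\to\mathbb K_\alpha$ be the canonical ring homomorphisms. Let $\mathcal D=\{0,1,\ldots,|a_0|-1\}$. There is exactly one non-empty compact set $\mathcal F\subset\mathbb K_\alpha$ with $\Phi_\alpha(\alpha)\,\mathcal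 F=\bigcup_{d\in\mathcal D}(\mathcal F+\Phi_\alpha(d))$. For $x\in\mathbb Z[\alpha]$ define the intersective tile $$\mathcal G(x)=\{y\in\mathbb K_\infty:\ (y,0)\in\mathcal F+\Phi_\alpha(x)\}.$$ Let $w_0=a_n$ and $w_i=\alpha w_{i-1}+a_{n-i}$ for $1\le i<n$. Then $w_0,\ldots,w_{n-1}$ is a $\mathbb Z$-basis of $\Lambda_{\alpha,0}=\mathbb Z[\alpha]\cap\alpha^{-1}\mathbb Z[\alpha^{-1}]$. Put $\iota_\alpha:\mathbb Q^n\to K$, $\iota_\alpha(z_0,\ldots,z_{n-1})=\operatorname{sgn}(a_0)\sum_{i=0}^{n-1}z_iw_i$. Let $\mathbf r=(\frac{a_n}{a_0},\ldots,\frac{a_1}{a_0})\in\mathbb{R}^n$, let $\tau_{\mathbf r}:\mathbb Z^n\to\mathbb Z^n$, $\tau_{\mathbf r}(z_1,\ldots,z_n)=(z_2,\ldots,z_n,-\lfloor\mathbf r\mathbf z\rfloor)$, where $\mathbf r\mathbf z$ is the scalar product, and let $\mathbf M_{\mathbf r}$ be the $n\times n$ matrix with ones on the superdiagonal, last row $-\mathbf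 r$ and all other entries $0$. For every $\mathbf z\in\mathbb Z^n$ the sets $\mathbf M_{\mathbf r}^k\,\tau_{\mathbf r}^{-k}(\mathbf z)$ (with $\tau_{\mathbf r}^{-k}(\mathbf z)$ the full preimage of $\mathbf z$ under $\tau_{\mathbf r}^k$) converge in the Hausdorff metric, as $k\to\infty$, to a unique non-empty compact set $\mathcal T_{\mathbf r}(\mathbf z)\subset\mathbb R^n$, the SRS tile at $\mathbf z$. Let $\Upsilon:\mathbb R^n\to\mathbb K_\infty$ be the $\mathbb R$-linear map that is equal to $\Phi_\infty\circ\iota_\alpha$ on $\mathbb Q^n$. Then $$\mathcal G(\iota_\alpha(\mathbf z))=\Upsilon(\mathcal T_{\mathbf r}(\mathbf z))\qquad\text{for all }\mathbf z\in\mathbb Z^n.$$ In particular, the collections $\{\mathcal G(x):x\in\Lambda_{\alpha,0}\}$ and $\{\Upsilon(\mathcal T_{\mathbf r}(\mathbf z)):\mathbf z\in\mathbb Z^n\}$ coincide. -/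

import Mathlib

open Polynomial NumberField IsDedekindDomain Filter Topology

noncomputable section

namespace RationalTile

section Field

variable {K : Type*} [Field K]

/-- `A` is a primitive minimal polynomial of `α`: a polynomial in `ℤ[X]` with coprime coefficients
which is its leading coefficient times the monic minimal polynomial of `α` over `ℚ`
(so `A` is determined by `α` up to sign). -/
def IsPrimitiveMinpoly [Algebra ℚ K] (A : ℤ[X]) (α : K) : Prop :=
  A.IsPrimitive ∧
    A.map (Int.castRingHom ℚ) = Polynomial.C (A.leadingCoeff : ℚ) * minpoly ℚ α

/-- Every complex root of `A` lies outside the closed unit disk. -/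
def IsExpanding (A : ℤ[X]) : Prop :=
  ∀ z : ℂ, Polynomial.aeval z A = 0 → 1 < ‖z‖

/-- The digit set `{0, 1, …, |a₀| - 1}`. -/
def digitSet (A : ℤ[X]) (K : Type*) [Field K] : Set K :=
  {d | ∃ m : ℕ, m < (A.coeff 0).natAbs ∧ d = (m : K)}

/-- `Λ_{α,m} = ℤ[α] ∩ α^{m-1} ℤ[α⁻¹]`. -/
def Lam (α : K) (m : ℤ) : Set K :=
  {x | x ∈ Algebra.adjoin ℤ {α} ∧ ∃ y ∈ Algebra.adjoin ℤ {α⁻¹}, x = α ^ (m - 1) * y}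

/-- `w₀ = a_n` and `w_i = α w_{i-1} + a_{n-i}`, where `n` is the degree of `A`. -/
def w (A : ℤ[X]) (α : K) : ℕ → K
  | 0 => ((A.coeff A.natDegree : ℤ) : K)
  | i + 1 => α * w A α i + ((A.coeff (A.natDegree - (i + 1)) : ℤ) : K)

/-- `ι_α(z) = sgn(a₀) ∑ z_i w_i`, on `ℚⁿ`. -/
def iota [Algebra ℚ K] (A : ℤ[X]) (α : K) (z : Fin A.natDegree → ℚ) : K :=
  (((A.coeff 0).sign : ℤ) : K) * ∑ i : Fin A.natDegree, algebraMap ℚ K (z i) * w A α i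

end Field

section Space

variable {K : Type*} [Field K] [NumberField K]

/-- `K_𝔟`, the product of the completions `K_𝔭` over the primes `𝔭` dividing `𝔟`. -/
abbrev FiniteSpace (K : Type*) [Field K] [NumberField K] (𝔟 : Ideal (𝓞 K)) : Type _ :=
  (v : {v : HeightOneSpectrum (𝓞 K) // v.asIdeal ∣ 𝔟}) → v.1.adicCompletion K

/-- The representation space `K_α = K_∞ × K_𝔟`, with `K_∞ = ℝ^r × ℂ^s`. -/
abbrev RepSpace (K : Type*) [Field K] [NumberField K] (𝔟 : Ideal (𝓞 K)) : Type _ :=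
  mixedEmbedding.mixedSpace K × FiniteSpace K 𝔟

/-- The diagonal embedding `Φ_α : K → K_α`; its component `Φ_∞` is `mixedEmbedding K`. -/
def Phi (𝔟 : Ideal (𝓞 K)) : K →+* RepSpace K 𝔟 :=
  (mixedEmbedding K).prod
    (RingHom.pi fun v : {v : HeightOneSpectrum (𝓞 K) // v.asIdeal ∣ 𝔟} =>
      algebraMap K (v.1.adicCompletion K))

/-- `F` is a non-empty compact set with `α · F = ⋃_{d ∈ D} (F + Φ_α(d))`. -/
structure IsSelfAffineTile (α : K) (𝔟 : Ideal (𝓞 K)) (D : Set K) (F : Set (RepSpace K 𝔟)) :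
    Prop where
  nonempty : F.Nonempty
  isCompact : IsCompact F
  set_eq : (fun z => Phi 𝔟 α * z) '' F = ⋃ d ∈ D, (fun z => z + Phi 𝔟 d) '' F

/-- The intersective tile `G(x)`: the part of `F + Φ_α(x)` with vanishing `𝔭`-adic coordinates for
all `𝔭 ∣ 𝔟`, regarded as a subset of `K_∞`. -/
def intersectiveTile {𝔟 : Ideal (𝓞 K)} (F : Set (RepSpace K 𝔟)) (x : K) :
    Set (mixedEmbedding.mixedSpace K) :=
  {y | ((y, 0) : RepSpace K 𝔟) ∈ (fun z => z + Phi 𝔟 x) '' F}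

end Space

section SRS

variable {n : ℕ}

/-- The shift radix system `τ_r(z) = (z₂, …, z_n, -⌊r z⌋)`. -/
def tau (r : Fin n → ℝ) (z : Fin n → ℤ) : Fin n → ℤ := fun i =>
  if h : (i : ℕ) + 1 < n then z ⟨i + 1, h⟩ else -⌊∑ j, r j * (z j : ℝ)⌋

/-- The companion matrix `M_r`: ones on the superdiagonal and last row `-r`. -/
def companion (r : Fin n → ℝ) : Matrix (Fin n) (Fin n) ℝ := Matrix.of fun i j =>
  if (i : ℕ) + 1 < n then (if (j : ℕ) = i + 1 then 1 else 0) else -r j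

/-- The set `M_r^k τ_r^{-k}(z)`, where `τ_r^{-k}(z)` is the full preimage under the `k`-th iterate. -/
def srsApprox (r : Fin n → ℝ) (z : Fin n → ℤ) (k : ℕ) : Set (Fin n → ℝ) :=
  {x | ∃ y : Fin n → ℤ, (tau r)^[k] y = z ∧
    x = Matrix.mulVec (companion r ^ k) (fun i => (y i : ℝ))}

/-- `T` is the SRS tile `T_r(z)`, the Hausdorff limit of `M_r^k τ_r^{-k}(z)` as `k → ∞`.
(Equivalent norms on `ℝⁿ` give the same Hausdorff limits.) -/
structure IsSRSTile (r : Fin n → ℝ) (z : Fin n → ℤ) (T : Set (Fin n → ℝ)) : Prop where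
  nonempty : T.Nonempty
  isCompact : IsCompact T
  tendsto : Tendsto (fun k => Metric.hausdorffEDist (srsApprox r z k) T) atTop (𝓝 0)

/-- The parameter `r = (a_n / a₀, …, a₁ / a₀)`. -/
def param (A : ℤ[X]) : Fin A.natDegree → ℝ := fun i =>
  (A.coeff (A.natDegree - i) : ℝ) / (A.coeff 0 : ℝ)

end SRS

end RationalTile

end

/-!
Write `n = deg A`. Under `ι_α`, the shift radix system `τ_r` becomes exact division by `α` on
`Λ_{α,0}` after subtraction of a digit: `τ_r(y) = z` holds if and only if
`ι_α(y) = α ι_α(z) + d` for some digit `d`. On the other hand `Υ` intertwines `M_r` with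
multiplication by `Φ_∞(α)⁻¹`. Hence the set equation of `F`, restricted to vanishing `𝔭`-adic
coordinates, turns into `Υ⁻¹(G(ι_α(z))) = ⋃ M_r Υ⁻¹(G(ι_α(y)))` over all `y` with `τ_r(y) = z`.
Iterating this equation `k` times shows that the left-hand side is at Hausdorff distance
`O(‖M_r ^ k‖)` from `M_r ^ k τ_r^{-k}(z)`, and `M_r ^ k → 0` because `α` is expanding.

Two facts about the tiles enter. First, `G(x) = ∅` for `x ∈ ℤ[α] \ Λ_{α,0}`: the `𝔭`-adic
coordinates of `F` lie in `α⁻¹𝓞_𝔭`, so `G(x) ≠ ∅` forces `αx ∈ 𝓞`; as `𝓞` is finitely generated, a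
single exponent gives `αx ∈ α ^ m ℤ[α⁻¹]` for all these `x`, and the set equation lowers `m` to `0`.
Second, `G(x) ≠ ∅` for `x ∈ Λ_{α,0}`: as `0 < |a_n / a₀| ≤ 1`, the map `τ_r` is onto, and backward
orbits of `x` give points of `F + Φ_α(x)` whose `𝔭`-adic coordinates tend to `0`.
-/

noncomputable section

namespace RationalTile

section Polynomials

theorem coeff_divX_iterate {R : Type*} [Semiring R] (P : R[X]) (k i : ℕ) :
    (divX^[k] P).coeff i = P.coeff (i + k) := by
  induction k generalizing i with
  | zero => rfl
  | succ k ih => rw [Function.iterate_succ_apply', coeff_divX, ih, add_right_comm, add_assoc]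

theorem divX_iterate_natDegree {R : Type*} [Semiring R] (P : R[X]) :
    divX^[P.natDegree] P = C P.leadingCoeff := by
  ext i
  rw [coeff_divX_iterate, coeff_C]
  split_ifs with h
  · rw [h, zero_add, leadingCoeff]
  · exact coeff_eq_zero_of_natDegree_lt (by omega)

theorem divX_iterate_of_natDegree_lt {R : Type*} [Semiring R] {P : R[X]} {N : ℕ}
    (hP : P.natDegree < N) : divX^[N] P = 0 := by
  ext i
  rw [coeff_divX_iterate, coeff_zero, coeff_eq_zero_of_natDegree_lt (by omega)]

theorem aeval_reverse {R L : Type*} [CommSemiring R] [Field L] [Algebra R L] {x : L} (hx : x ≠ 0)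
    (P : R[X]) : aeval x P.reverse = x ^ P.natDegree * aeval x⁻¹ P := by
  let _ : Invertible x⁻¹ := ⟨x, mul_inv_cancel₀ hx, inv_mul_cancel₀ hx⟩
  have h : aeval x P.reverse * x⁻¹ ^ P.natDegree = aeval x⁻¹ P :=
    eval₂_reverse_mul_pow (algebraMap R L) x⁻¹ P
  rw [← h, mul_left_comm, ← mul_pow, mul_inv_cancel₀ hx, one_pow, mul_one]

theorem norm_leadingCoeff_le_norm_coeff_zero {L : Type*} [NormedField L] {P : L[X]}
    (hP : P.Splits) (h : ∀ z ∈ P.roots, 1 ≤ ‖z‖) : ‖P.leadingCoeff‖ ≤ ‖P.coeff 0‖ := by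
  have hprod : 1 ≤ ‖P.roots.prod‖ :=
    P.roots.prod_induction (1 ≤ ‖·‖)
      (fun a b ha hb => (one_le_mul_of_one_le_of_one_le ha hb).trans_eq (norm_mul a b).symm)
      norm_one.ge h
  calc ‖P.leadingCoeff‖ ≤ ‖P.leadingCoeff‖ * ‖P.roots.prod‖ :=
        le_mul_of_one_le_right (norm_nonneg _) hprod
    _ = ‖P.coeff 0‖ := by
        rw [hP.coeff_zero_eq_leadingCoeff_mul_prod_roots, norm_mul, norm_mul, norm_pow, norm_neg,
          norm_one, one_pow, one_mul]

variable {A : ℤ[X]}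

theorem IsExpanding.coeff_zero_ne_zero (hexp : IsExpanding A) : A.coeff 0 ≠ 0 := by
  intro h
  have : (1 : ℝ) < ‖(0 : ℂ)‖ := hexp 0 (by rw [aeval_def, eval₂_at_zero, h, map_zero])
  exact this.not_ge (norm_zero.trans_le zero_le_one)

theorem IsExpanding.abs_leadingCoeff_le (hexp : IsExpanding A) :
    |A.leadingCoeff| ≤ |A.coeff 0| := by
  have h := norm_leadingCoeff_le_norm_coeff_zero
    (IsAlgClosed.splits (A.map (algebraMap ℤ ℂ))) fun z hz => (hexp z ?_).le
  · rw [leadingCoeff_map_of_injective (algebraMap ℤ ℂ).injective_int, coeff_map, eq_intCast,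
      eq_intCast, Complex.norm_intCast, Complex.norm_intCast] at h
    exact_mod_cast h
  · rw [aeval_def, ← eval_map]
    exact isRoot_of_mem_roots hz

variable {K : Type*} [Field K] [CharZero K] {α : K}

theorem IsPrimitiveMinpoly.aeval_eq_zero (hA : IsPrimitiveMinpoly A α) : aeval α A = 0 := by
  rw [← aeval_map_algebraMap ℚ α A, algebraMap_int_eq, hA.2, map_mul, minpoly.aeval, mul_zero]

theorem IsPrimitiveMinpoly.leadingCoeff_cast_ne_zero {R : Type*} [Ring R] [CharZero R]
    (hA : IsPrimitiveMinpoly A α) : (A.leadingCoeff : R) ≠ 0 :=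
  Int.cast_ne_zero.2 (leadingCoeff_ne_zero.2 hA.1.ne_zero)

theorem IsPrimitiveMinpoly.dvd_of_aeval_eq_zero (hA : IsPrimitiveMinpoly A α) {P : ℤ[X]}
    (hP : aeval α P = 0) : A ∣ P := by
  rw [IsPrimitive.Int.dvd_iff_map_cast_dvd_map_cast _ _ hA.1, hA.2,
    (isUnit_C.2 hA.leadingCoeff_cast_ne_zero.isUnit).mul_left_dvd]
  refine minpoly.dvd ℚ α ?_
  rw [← algebraMap_int_eq, aeval_map_algebraMap, hP]

theorem IsPrimitiveMinpoly.natDegree_eq (hA : IsPrimitiveMinpoly A α) :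
    A.natDegree = (minpoly ℚ α).natDegree := by
  have h := congrArg natDegree hA.2
  rwa [natDegree_map_eq_of_injective Int.cast_injective,
    natDegree_C_mul hA.leadingCoeff_cast_ne_zero] at h

theorem IsPrimitiveMinpoly.ne_zero (hA : IsPrimitiveMinpoly A α) (h : A.coeff 0 ≠ 0) : α ≠ 0 := by
  rintro rfl
  have := hA.aeval_eq_zero
  rw [aeval_def, eval₂_at_zero, eq_intCast] at this
  exact h (Int.cast_eq_zero.1 this)

end Polynomials

section Lattice

variable {K : Type*} [Field K] {A : ℤ[X]} {α : K}

/-- `Λ_{α,0} = ℤ[α] ∩ α⁻¹ ℤ[α⁻¹]` as a `ℤ`-module, the condition `x ∈ α⁻¹ ℤ[α⁻¹]` being encoded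
as `α x ∈ ℤ[α⁻¹]`. -/
def lamZero (α : K) : Submodule ℤ K :=
  (Algebra.adjoin ℤ {α}).toSubmodule ⊓
    (Algebra.adjoin ℤ {α⁻¹}).toSubmodule.comap (LinearMap.mulLeft ℤ α)

theorem mem_lamZero {x : K} :
    x ∈ lamZero α ↔ x ∈ Algebra.adjoin ℤ {α} ∧ α * x ∈ Algebra.adjoin ℤ {α⁻¹} :=
  Iff.rfl

theorem coe_lamZero (hα : α ≠ 0) : (lamZero α : Set K) = Lam α 0 := by
  ext x
  refine and_congr_right fun _ => ⟨fun h => ⟨_, h, ?_⟩, ?_⟩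
  · rw [zero_sub, zpow_neg_one, LinearMap.mulLeft_apply, inv_mul_cancel_left₀ hα]
  · rintro ⟨y, hy, rfl⟩
    change α * _ ∈ Algebra.adjoin ℤ {α⁻¹}
    rwa [zero_sub, zpow_neg_one, mul_inv_cancel_left₀ hα]

theorem mul_w (i : ℕ) :
    α * w A α i = w A α (i + 1) - (A.coeff (A.natDegree - (i + 1)) : K) :=
  (add_sub_cancel_right _ _).symm

theorem w_natDegree_sub_eq_aeval {m : ℕ} (hm : m ≤ A.natDegree) :
    w A α (A.natDegree - m) = aeval α (divX^[m] A) := by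
  induction hm using Nat.decreasingInduction with
  | self => rw [divX_iterate_natDegree, aeval_C, Nat.sub_self, w, leadingCoeff, eq_intCast]
  | of_succ k hk ih =>
    have hsucc : A.natDegree - k = A.natDegree - (k + 1) + 1 := by omega
    have hcoeff : A.natDegree - (A.natDegree - (k + 1) + 1) = k := by omega
    rw [hsucc, w, ih, hcoeff, ← divX_mul_X_add (divX^[k] A), ← Function.iterate_succ_apply' divX,
      map_add, map_mul, aeval_X, aeval_C, coeff_divX_iterate, zero_add, eq_intCast, mul_comm]

theorem w_natDegree (hA : aeval α A = 0) : w A α A.natDegree = 0 :=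
  (w_natDegree_sub_eq_aeval (Nat.zero_le _)).trans hA

theorem w_mem_adjoin (i : ℕ) : w A α i ∈ Algebra.adjoin ℤ {α} := by
  induction i with
  | zero => exact intCast_mem _ _
  | succ i ih =>
    exact add_mem (mul_mem (Algebra.self_mem_adjoin_singleton ℤ α) ih) (intCast_mem _ _)

theorem w_mem_adjoin_inv (hA : aeval α A = 0) (hα : α ≠ 0) {i : ℕ} (hi : i ≤ A.natDegree) :
    w A α i ∈ Algebra.adjoin ℤ {α⁻¹} := by
  induction hi using Nat.decreasingInduction with
  | self => exact w_natDegree hA ▸ zero_mem _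
  | of_succ k hk ih =>
    rw [← inv_mul_cancel_left₀ hα (w A α k), mul_w]
    exact mul_mem (Algebra.self_mem_adjoin_singleton ℤ _) (sub_mem ih (intCast_mem _ _))

theorem w_mem_lamZero (hA : aeval α A = 0) (hα : α ≠ 0) {i : ℕ} (hi : i < A.natDegree) :
    w A α i ∈ lamZero α :=
  mem_lamZero.2 ⟨w_mem_adjoin i, mul_w (A := A) (α := α) i ▸
    sub_mem (w_mem_adjoin_inv hA hα (Nat.succ_le_of_lt hi)) (intCast_mem _ _)⟩

theorem aeval_divX_iterate_mem_span (hA : aeval α A = 0) (N : ℕ) :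
    aeval α (divX^[N] A) ∈ Submodule.span ℤ (Set.range fun i : Fin A.natDegree => w A α i) := by
  rcases le_or_gt N A.natDegree with hN | hN
  · rw [← w_natDegree_sub_eq_aeval hN]
    rcases (Nat.sub_le A.natDegree N).lt_or_eq with h | h
    · exact Submodule.subset_span ⟨⟨_, h⟩, rfl⟩
    · rw [h, w_natDegree hA]
      exact zero_mem _
  · rw [divX_iterate_of_natDegree_lt hN, map_zero]
    exact zero_mem _

theorem aeval_divX_iterate_mul_mem_span (hA : aeval α A = 0) (N : ℕ) (B : ℤ[X]) :
    aeval α (divX^[N] (A * B)) ∈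
      Submodule.span ℤ (Set.range fun i : Fin A.natDegree => w A α i) := by
  induction N generalizing B with
  | zero =>
    rw [Function.iterate_zero_apply, map_mul, hA, zero_mul]
    exact zero_mem _
  | succ N ih =>
    have hB : A * B = B.coeff 0 • A + A * divX B * X := by
      conv_lhs => rw [← divX_mul_X_add B]
      rw [smul_eq_C_mul]
      ring
    have hsplit : divX^[N + 1] (A * B) = B.coeff 0 • divX^[N + 1] A + divX^[N] (A * divX B) := by
      ext i
      rw [coeff_divX_iterate, hB, coeff_add, coeff_smul, coeff_add, coeff_smul, coeff_divX_iterate,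
        coeff_divX_iterate, ← add_assoc, coeff_mul_X]
    rw [hsplit, map_add, map_zsmul]
    exact add_mem (Submodule.smul_mem _ _ (aeval_divX_iterate_mem_span hA _)) (ih _)

theorem IsPrimitiveMinpoly.span_w_eq_lamZero [CharZero K] (hA : IsPrimitiveMinpoly A α)
    (hα : α ≠ 0) :
    Submodule.span ℤ (Set.range fun i : Fin A.natDegree => w A α i) = lamZero α := by
  refine le_antisymm (Submodule.span_le.2 ?_) fun x hx => ?_
  · rintro _ ⟨i, rfl⟩
    exact w_mem_lamZero hA.aeval_eq_zero hα i.2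
  · obtain ⟨P, rfl⟩ := Algebra.adjoin_mem_exists_aeval ℤ α (mem_lamZero.1 hx).1
    obtain ⟨Q, hQ⟩ := Algebra.adjoin_mem_exists_aeval ℤ α⁻¹ (mem_lamZero.1 hx).2
    obtain ⟨B, hB⟩ : A ∣ X ^ (Q.natDegree + 1) * P - Q.reverse := by
      refine hA.dvd_of_aeval_eq_zero ?_
      rw [map_sub, map_mul, map_pow, aeval_X, aeval_reverse hα, hQ]
      ring
    have htrunc : divX^[Q.natDegree + 1] (A * B) = P := by
      ext i
      rw [coeff_divX_iterate, ← hB, coeff_sub, coeff_X_pow_mul,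
        coeff_eq_zero_of_natDegree_lt (p := Q.reverse), sub_zero]
      exact (reverse_natDegree_le Q).trans_lt (by omega)
    exact htrunc ▸ aeval_divX_iterate_mul_mem_span hA.aeval_eq_zero _ B

end Lattice

section Coordinates

theorem submodule_eq_top_of_mul_mem {F L : Type*} [Field F] [Field L] [Algebra F L]
    [Algebra.IsAlgebraic F L] {α : L} (hα : IntermediateField.adjoin F {α} = ⊤)
    {V : Submodule F L} (hone : 1 ∈ V) (hmul : ∀ v ∈ V, α * v ∈ V) : V = ⊤ := by
  have hadjoin : Algebra.adjoin F {α} = ⊤ :=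
    (IntermediateField.adjoin_simple_eq_top_iff_of_isAlgebraic
      (Algebra.IsAlgebraic.isAlgebraic α)).1 hα
  have hstable : ∀ x ∈ Algebra.adjoin F {α}, ∀ v ∈ V, x * v ∈ V := by
    intro x hx
    induction hx using Algebra.adjoin_induction with
    | mem x hx => exact Set.mem_singleton_iff.1 hx ▸ hmul
    | algebraMap c => exact fun v hv => Algebra.smul_def c v ▸ V.smul_mem c hv
    | add x y _ _ hx hy => exact fun v hv => add_mul x y v ▸ add_mem (hx v hv) (hy v hv)
    | mul x y _ _ hx hy => exact fun v hv => mul_assoc x y v ▸ hx _ (hy v hv)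
  exact eq_top_iff.2 fun x _ => mul_one x ▸ hstable x (hadjoin ▸ Algebra.mem_top) 1 hone

variable {K : Type*} [Field K] [CharZero K] {A : ℤ[X]} {α : K}

theorem iota_eq_sum_smul (z : Fin A.natDegree → ℚ) :
    iota A α z = ((A.coeff 0).sign : ℚ) • ∑ i : Fin A.natDegree, z i • w A α i := by
  simp only [iota, Algebra.smul_def, map_intCast]

/-- `ι_α(z)` for `z ∈ ℤⁿ`; these are the elements of `Λ_{α,0}`. -/
abbrev latticePoint (A : ℤ[X]) (α : K) (z : Fin A.natDegree → ℤ) : K :=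
  iota A α fun i => (z i : ℚ)

theorem latticePoint_eq_sum_smul (z : Fin A.natDegree → ℤ) :
    latticePoint A α z = (A.coeff 0).sign • ∑ i : Fin A.natDegree, z i • w A α i := by
  simp only [latticePoint, iota_eq_sum_smul, Int.cast_smul_eq_zsmul]

theorem IsPrimitiveMinpoly.mem_lamZero_iff_exists_latticePoint (hA : IsPrimitiveMinpoly A α)
    (h0 : A.coeff 0 ≠ 0) {x : K} : x ∈ lamZero α ↔ ∃ z, latticePoint A α z = x := by
  rw [← hA.span_w_eq_lamZero (hA.ne_zero h0), Submodule.mem_span_range_iff_exists_fun]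
  have hsq : (A.coeff 0).sign * (A.coeff 0).sign = 1 := by
    rw [← Int.sign_mul, Int.sign_eq_one_of_pos (mul_self_pos.2 h0)]
  constructor
  · rintro ⟨c, rfl⟩
    exact ⟨(A.coeff 0).sign • c, by
      simp only [latticePoint_eq_sum_smul, Finset.smul_sum, Pi.smul_apply, smul_smul, smul_eq_mul,
        ← mul_assoc, hsq, one_mul]⟩
  · rintro ⟨z, rfl⟩
    exact ⟨(A.coeff 0).sign • z, by
      simp only [latticePoint_eq_sum_smul, Finset.smul_sum, Pi.smul_apply, smul_smul, smul_eq_mul]⟩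

/-- `α` is an expanding algebraic number generating `K`, with primitive minimal polynomial `A`. -/
structure IsExpandingGenerator (α : K) (A : ℤ[X]) : Prop where
  adjoin_eq_top : IntermediateField.adjoin ℚ {α} = ⊤
  isPrimitiveMinpoly : IsPrimitiveMinpoly A α
  isExpanding : IsExpanding A

end Coordinates

namespace IsExpandingGenerator

variable {K : Type*} [Field K] [NumberField K] {A : ℤ[X]} {α : K}

theorem aeval_eq_zero (h : IsExpandingGenerator α A) : aeval α A = 0 :=
  h.isPrimitiveMinpoly.aeval_eq_zero

theorem coeff_zero_ne_zero (h : IsExpandingGenerator α A) : A.coeff 0 ≠ 0 :=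
  h.isExpanding.coeff_zero_ne_zero

theorem ne_zero (h : IsExpandingGenerator α A) : α ≠ 0 :=
  h.isPrimitiveMinpoly.ne_zero h.coeff_zero_ne_zero

theorem natDegree_eq_finrank (h : IsExpandingGenerator α A) :
    A.natDegree = Module.finrank ℚ K := by
  rw [h.isPrimitiveMinpoly.natDegree_eq,
    ← IntermediateField.adjoin.finrank (Algebra.IsIntegral.isIntegral α), h.adjoin_eq_top,
    IntermediateField.finrank_top']

theorem natDegree_pos (h : IsExpandingGenerator α A) : 0 < A.natDegree :=
  h.natDegree_eq_finrank ▸ Module.finrank_pos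

theorem rat_span_w_eq_top (h : IsExpandingGenerator α A) :
    Submodule.span ℚ (Set.range fun i : Fin A.natDegree => w A α i) = ⊤ := by
  set V := Submodule.span ℚ (Set.range fun i : Fin A.natDegree => w A α i)
  have hwV : ∀ i ≤ A.natDegree, w A α i ∈ V := by
    intro i hi
    rcases hi.lt_or_eq with hi | rfl
    · exact Submodule.subset_span ⟨⟨i, hi⟩, rfl⟩
    · exact w_natDegree h.aeval_eq_zero ▸ zero_mem _
  have hone : (1 : K) ∈ V := by
    have hw0 : w A α 0 = (A.leadingCoeff : ℚ) • (1 : K) := by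
      rw [Rat.smul_one_eq_cast, Rat.cast_intCast, w, leadingCoeff]
    exact (V.smul_mem_iff h.isPrimitiveMinpoly.leadingCoeff_cast_ne_zero).1
      (hw0 ▸ hwV 0 (Nat.zero_le _))
  refine submodule_eq_top_of_mul_mem h.adjoin_eq_top hone fun v hv => ?_
  induction hv using Submodule.span_induction with
  | mem x hx =>
    obtain ⟨i, rfl⟩ := hx
    dsimp only
    rw [mul_w, ← Rat.cast_intCast, ← Rat.smul_one_eq_cast]
    exact sub_mem (hwV _ i.2) (V.smul_mem _ hone)
  | zero =>
    rw [mul_zero]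
    exact zero_mem V
  | add x y _ _ hx hy => exact mul_add α x y ▸ add_mem hx hy
  | smul c x _ hx => exact mul_smul_comm c α x ▸ V.smul_mem c hx

theorem linearIndependent_w (h : IsExpandingGenerator α A) :
    LinearIndependent ℤ fun i : Fin A.natDegree => w A α i :=
  (linearIndependent_of_top_le_span_of_card_eq_finrank (R := ℚ) h.rat_span_w_eq_top.ge
    (by rw [Fintype.card_fin, h.natDegree_eq_finrank])).restrict_scalars' ℤ

theorem iota_surjective (h : IsExpandingGenerator α A) :
    Function.Surjective (iota A α) := by
  intro x
  have hsign : ((A.coeff 0).sign : ℚ) ≠ 0 :=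
    Int.cast_ne_zero.2 (Int.sign_eq_zero_iff_zero.not.2 h.coeff_zero_ne_zero)
  have hx : ((A.coeff 0).sign : ℚ)⁻¹ • x ∈
      Submodule.span ℚ (Set.range fun i : Fin A.natDegree => w A α i) :=
    h.rat_span_w_eq_top ▸ Submodule.mem_top
  obtain ⟨q, hq⟩ := Submodule.mem_span_range_iff_exists_fun ℚ |>.1 hx
  exact ⟨q, by rw [iota_eq_sum_smul, hq, smul_inv_smul₀ hsign]⟩

end IsExpandingGenerator

section ShiftRadixSystems

variable {n : ℕ}

/-- `(x₂, …, x_n, c)`: the common shape of `τ_r(x)`, where `c` is an integer part, and of `M_r x`,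
where it is not. -/
def shift {S : Type*} (x : Fin n → S) (c : S) : Fin n → S := fun i =>
  if h : (i : ℕ) + 1 < n then x ⟨i + 1, h⟩ else c

theorem tau_eq_shift (r : Fin n → ℝ) (z : Fin n → ℤ) :
    tau r z = shift z (-⌊∑ j, r j * (z j : ℝ)⌋) :=
  rfl

theorem companion_mulVec (r x : Fin n → ℝ) :
    (companion r).mulVec x = shift x (-∑ j, r j * x j) := by
  ext i
  rw [Matrix.mulVec, dotProduct, shift]
  by_cases h : (i : ℕ) + 1 < n
  · have hval : ∀ j : Fin n, (j : ℕ) = i + 1 ↔ j = ⟨i + 1, h⟩ := fun j =>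
      (Fin.ext_iff (b := ⟨i + 1, h⟩)).symm
    simp only [companion, Matrix.of_apply, if_pos h, dif_pos h, hval, ite_mul, one_mul, zero_mul,
      Finset.sum_ite_eq', Finset.mem_univ, if_true]
  · simp only [companion, Matrix.of_apply, if_neg h, dif_neg h, neg_mul, Finset.sum_neg_distrib]

theorem sum_shift_smul {S M : Type*} [Semiring S] [AddCommMonoid M] [Module S M] {v : ℕ → M}
    (hv : v 0 = 0) (x : Fin n → S) (c : S) :
    ∑ i : Fin n, shift x c i • v (i + 1) = ∑ i : Fin n, x i • v i + c • v n := by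
  cases n with
  | zero => simp only [Finset.univ_eq_empty, Finset.sum_empty, hv, smul_zero, add_zero]
  | succ n =>
    have hcast : ∀ i : Fin n, shift x c i.castSucc = x i.succ := fun i => dif_pos (by simp)
    have hlast : shift x c (Fin.last n) = c := dif_neg (by simp)
    rw [Fin.sum_univ_castSucc, Fin.sum_univ_succ]
    simp only [hcast, hlast, Fin.val_castSucc, Fin.val_succ, Fin.val_last, Fin.val_zero, hv,
      smul_zero, zero_add]

theorem intCast_tau (r : Fin n → ℝ) (y : Fin n → ℤ) : (fun i => (tau r y i : ℝ)) =
    shift (fun i => (y i : ℝ)) (Int.fract (∑ i, r i * y i) - ∑ i, r i * y i) := by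
  ext i
  rw [tau_eq_shift, shift, shift]
  split_ifs
  · rfl
  · rw [← neg_sub, Int.self_sub_fract, Int.cast_neg]

theorem tau_eq_of_shift_eq {r : Fin n → ℝ} {y z : Fin n → ℤ} {t : ℝ} (ht : t ∈ Set.Ico 0 1)
    (h : shift (fun i => (y i : ℝ)) (t - ∑ i, r i * y i) = fun i => (z i : ℝ)) : tau r y = z := by
  ext i
  have hi := congrFun h i
  rw [shift] at hi
  rw [tau_eq_shift, shift]
  split_ifs at hi ⊢
  · exact Int.cast_injective hi
  · rw [neg_eq_iff_eq_neg, Int.floor_eq_iff, Int.cast_neg]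
    constructor <;> linarith [ht.1, ht.2]

theorem exists_floor_mul_add_eq {r : ℝ} (hr : r ≠ 0) (hr1 : |r| ≤ 1) (s : ℝ) (t : ℤ) :
    ∃ c : ℤ, ⌊r * c + s⌋ = t := by
  rcases lt_or_gt_of_ne hr with hneg | hpos
  · rw [abs_of_neg hneg] at hr1
    refine ⟨⌊(t - s) / r⌋, Int.floor_eq_iff.2 ⟨?_, ?_⟩⟩
    · linarith [mul_le_mul_of_nonpos_left (Int.floor_le ((t - s) / r)) hneg.le,
        mul_div_cancel₀ (t - s) hr]
    · linarith [mul_lt_mul_of_neg_left (Int.lt_floor_add_one ((t - s) / r)) hneg,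
        mul_div_cancel₀ (t - s) hr]
  · rw [abs_of_pos hpos] at hr1
    refine ⟨⌈(t - s) / r⌉, Int.floor_eq_iff.2 ⟨?_, ?_⟩⟩
    · linarith [mul_le_mul_of_nonneg_left (Int.le_ceil ((t - s) / r)) hpos.le,
        mul_div_cancel₀ (t - s) hr]
    · linarith [mul_lt_mul_of_pos_left (Int.ceil_lt_add_one ((t - s) / r)) hpos,
        mul_div_cancel₀ (t - s) hr]

theorem tau_surjective [NeZero n] {r : Fin n → ℝ} (hr : r 0 ≠ 0) (hr1 : |r 0| ≤ 1) :
    Function.Surjective (tau r) := by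
  intro z
  obtain ⟨n, rfl⟩ := Nat.exists_eq_succ_of_ne_zero (NeZero.ne n)
  obtain ⟨c, hc⟩ := exists_floor_mul_add_eq hr hr1
    (∑ i : Fin n, r i.succ * (z i.castSucc : ℝ)) (-z (Fin.last n))
  refine ⟨Fin.cons c (Fin.init z), funext fun i => ?_⟩
  rw [tau_eq_shift, shift, Fin.sum_univ_succ]
  induction i using Fin.lastCases with
  | last => simpa [Fin.init] using neg_eq_iff_eq_neg.2 hc
  | cast i => exact dif_pos (by simp)

end ShiftRadixSystems

section Tiles

variable {n : ℕ} {r : Fin n → ℝ}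

theorem IsSRSTile.unique {z : Fin n → ℤ} {T T' : Set (Fin n → ℝ)} (h : IsSRSTile r z T)
    (h' : IsSRSTile r z T') : T = T' := by
  have hzero : Metric.hausdorffEDist T T' = 0 := by
    have hlim := h.tendsto.add h'.tendsto
    rw [add_zero] at hlim
    refine nonpos_iff_eq_zero.1 (ge_of_tendsto' hlim fun k => ?_)
    rw [Metric.hausdorffEDist_comm (s := srsApprox r z k) (t := T)]
    exact Metric.hausdorffEDist_triangle
  exact (h.isCompact.isClosed.hausdorffEDist_zero_iff h'.isCompact.isClosed).1 hzero

theorem mem_iff_exists_iterate_tau {T : (Fin n → ℤ) → Set (Fin n → ℝ)}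
    (hT : ∀ z, T z = ⋃ (y) (_ : tau r y = z), (companion r).mulVec '' T y) (k : ℕ)
    {z : Fin n → ℤ} {x : Fin n → ℝ} :
    x ∈ T z ↔ ∃ y, (tau r)^[k] y = z ∧ ∃ u ∈ T y, (companion r ^ k).mulVec u = x := by
  induction k generalizing z x with
  | zero => simp only [Function.iterate_zero_apply, pow_zero, Matrix.one_mulVec, exists_eq_left,
      exists_eq_right]
  | succ k ih =>
    have hstep : ∀ z x, x ∈ T z ↔ ∃ y, tau r y = z ∧ ∃ u ∈ T y, (companion r).mulVec u = x := by
      intro z x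
      rw [hT z]
      simp only [Set.mem_iUnion, Set.mem_image, exists_prop]
    rw [ih]
    constructor
    · rintro ⟨y, hy, u, hu, rfl⟩
      obtain ⟨y', rfl, u', hu', rfl⟩ := (hstep y u).1 hu
      exact ⟨y', hy, u', hu', by rw [Matrix.mulVec_mulVec, pow_succ]⟩
    · rintro ⟨y, hy, u, hu, rfl⟩
      exact ⟨tau r y, hy, (companion r).mulVec u, (hstep _ _).2 ⟨y, rfl, u, hu, rfl⟩,
        by rw [Matrix.mulVec_mulVec, pow_succ]⟩

open scoped Matrix.Norms.Operator in
theorem isSRSTile_of_eq_iUnion_image {T : (Fin n → ℤ) → Set (Fin n → ℝ)}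
    (hT : ∀ z, T z = ⋃ (y) (_ : tau r y = z), (companion r).mulVec '' T y)
    (hne : ∀ z, (T z).Nonempty) (hcpt : ∀ z, IsCompact (T z)) {C : ℝ}
    (hC : ∀ z, ∀ x ∈ T z, ‖(fun i => (z i : ℝ)) - x‖ ≤ C)
    (hM : Tendsto (fun k => companion r ^ k) atTop (𝓝 0)) (z : Fin n → ℤ) :
    IsSRSTile r z (T z) := by
  refine ⟨hne z, hcpt z, ?_⟩
  have hlim : Tendsto (fun k => ENNReal.ofReal (‖companion r ^ k‖ * C)) atTop (𝓝 0) := by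
    have h := ENNReal.tendsto_ofReal (hM.norm.mul_const C)
    rwa [norm_zero, zero_mul, ENNReal.ofReal_zero] at h
  have hclose : ∀ k y, ∀ u ∈ T y, edist ((companion r ^ k).mulVec fun i => (y i : ℝ))
      ((companion r ^ k).mulVec u) ≤ ENNReal.ofReal (‖companion r ^ k‖ * C) := by
    intro k y u hu
    rw [edist_dist, dist_eq_norm, ← Matrix.mulVec_sub]
    exact ENNReal.ofReal_le_ofReal ((Matrix.linfty_opNorm_mulVec _ _).trans
      (mul_le_mul_of_nonneg_left (hC y u hu) (norm_nonneg _)))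
  refine tendsto_of_tendsto_of_tendsto_of_le_of_le tendsto_const_nhds hlim (fun _ => zero_le)
    fun k => Metric.hausdorffEDist_le_of_mem_edist ?_ fun x hx => ?_
  · rintro _ ⟨y, rfl, rfl⟩
    obtain ⟨u, hu⟩ := hne y
    exact ⟨_, (mem_iff_exists_iterate_tau hT k).2 ⟨y, rfl, u, hu, rfl⟩, hclose k y u hu⟩
  · obtain ⟨y, hy, u, hu, rfl⟩ := (mem_iff_exists_iterate_tau hT k).1 hx
    exact ⟨_, ⟨y, hy, rfl⟩, edist_comm (α := Fin n → ℝ) _ _ ▸ hclose k y u hu⟩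

end Tiles

section Upsilon

theorem exists_fract_intCast_div_natCast_eq (a : ℤ) {N : ℕ} (hN : 0 < N) :
    ∃ m < N, Int.fract ((a : ℝ) / N) = (m : ℝ) / N := by
  have hpos : (0 : ℤ) < N := Int.natCast_pos.2 hN
  obtain ⟨m, hm⟩ := Int.eq_ofNat_of_zero_le (Int.emod_nonneg a hpos.ne')
  have hlt := Int.emod_lt_of_pos a hpos
  refine ⟨m, by omega, ?_⟩
  rw [Int.fract_div_intCast_eq_div_intCast_mod, hm, Int.cast_natCast]

variable {K : Type*} [Field K] {A : ℤ[X]} {α : K}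

/-- The `ℝ`-linear map `Υ : ℝⁿ → K_∞` that extends `Φ_∞ ∘ ι_α`. -/
def upsilon (A : ℤ[X]) (α : K) : (Fin A.natDegree → ℝ) →ₗ[ℝ] mixedEmbedding.mixedSpace K :=
  ((A.coeff 0).sign : ℝ) •
    Fintype.linearCombination ℝ fun i : Fin A.natDegree => mixedEmbedding K (w A α i)

theorem upsilon_apply (x : Fin A.natDegree → ℝ) : upsilon A α x =
    ((A.coeff 0).sign : ℝ) • ∑ i : Fin A.natDegree, x i • mixedEmbedding K (w A α i) :=
  rfl

theorem mixedEmbedding_intCast (m : ℤ) :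
    mixedEmbedding K (m : K) = (m : ℝ) • (1 : mixedEmbedding.mixedSpace K) := by
  rw [map_intCast, Int.cast_smul_eq_zsmul, zsmul_one]

theorem mixedEmbedding_mul_upsilon_shift (hA : aeval α A = 0) (h0 : A.coeff 0 ≠ 0)
    (x : Fin A.natDegree → ℝ) (c : ℝ) :
    mixedEmbedding K α * upsilon A α (shift x c) = upsilon A α x -
      ((A.coeff 0).natAbs * (∑ i, param A i * x i + c) : ℝ) •
        (1 : mixedEmbedding.mixedSpace K) := by
  have h0' : (A.coeff 0 : ℝ) ≠ 0 := Int.cast_ne_zero.2 h0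
  have hsign : ((A.coeff 0).sign : ℝ) * A.coeff 0 = (A.coeff 0).natAbs := by
    rw [← Int.cast_mul, Int.sign_mul_self, Int.cast_natCast]
  -- The telescoping sequence `Φ_∞ (w i - a_{n-i})`: it vanishes at `0`, and its entry at `i + 1` is
  -- `Φ_∞ (α w i)`.
  set v : ℕ → mixedEmbedding.mixedSpace K := fun i =>
    mixedEmbedding K (w A α i) - (A.coeff (A.natDegree - i) : ℝ) • 1 with hv
  have hv0 : v 0 = 0 := by simp only [hv, w, mixedEmbedding_intCast, Nat.sub_zero, sub_self]
  have hvsucc : ∀ i, mixedEmbedding K α * mixedEmbedding K (w A α i) = v (i + 1) := fun i => by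
    rw [← map_mul, mul_w, map_sub, mixedEmbedding_intCast]
  have hvn : v A.natDegree = -((A.coeff 0 : ℝ) • 1) := by
    simp only [hv, w_natDegree hA, map_zero, Nat.sub_self, zero_sub]
  have hparam : ∀ i, x i * (A.coeff (A.natDegree - i) : ℝ) = A.coeff 0 * (param A i * x i) :=
    fun i => by rw [param]; field_simp
  have hsum : ∑ i : Fin A.natDegree, x i • v i =
      ∑ i : Fin A.natDegree, x i • mixedEmbedding K (w A α i) -
        (A.coeff 0 * ∑ i, param A i * x i : ℝ) • (1 : mixedEmbedding.mixedSpace K) := by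
    simp only [hv, smul_sub, Finset.sum_sub_distrib, smul_smul, hparam, ← Finset.sum_smul,
      ← Finset.mul_sum]
  simp only [upsilon_apply, mul_smul_comm, Finset.mul_sum, hvsucc]
  rw [sum_shift_smul hv0, hsum, hvn, ← hsign]
  module

theorem mixedEmbedding_mul_upsilon_companion (hA : aeval α A = 0) (h0 : A.coeff 0 ≠ 0)
    (x : Fin A.natDegree → ℝ) :
    mixedEmbedding K α * upsilon A α ((companion (param A)).mulVec x) = upsilon A α x := by
  rw [companion_mulVec, mixedEmbedding_mul_upsilon_shift hA h0, add_neg_cancel, mul_zero, zero_smul,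
    sub_zero]

variable [NumberField K]

theorem mixedEmbedding_rat_smul (q : ℚ) (x : K) :
    mixedEmbedding K (q • x) = (q : ℝ) • mixedEmbedding K x :=
  (map_rat_smul (mixedEmbedding K) q x).trans (Rat.cast_smul_eq_qsmul ℝ q _).symm

theorem upsilon_ratCast (q : Fin A.natDegree → ℚ) :
    upsilon A α (fun i => (q i : ℝ)) = mixedEmbedding K (iota A α q) := by
  simp only [iota_eq_sum_smul, mixedEmbedding_rat_smul, map_sum, upsilon_apply, Rat.cast_intCast]

theorem upsilon_intCast (z : Fin A.natDegree → ℤ) :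
    upsilon A α (fun i => (z i : ℝ)) = mixedEmbedding K (latticePoint A α z) := by
  rw [latticePoint, ← upsilon_ratCast]
  simp only [Rat.cast_intCast]

theorem IsExpandingGenerator.upsilon_bijective (h : IsExpandingGenerator α A) :
    Function.Bijective (upsilon A α) := by
  have hsurj : Function.Surjective (upsilon A α) := by
    rw [← LinearMap.range_eq_top, eq_top_iff, ← (mixedEmbedding.latticeBasis K).span_eq,
      Submodule.span_le]
    rintro _ ⟨i, rfl⟩
    rw [mixedEmbedding.latticeBasis_apply]
    obtain ⟨q, hq⟩ := h.iota_surjective (integralBasis K i)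
    exact ⟨_, hq ▸ upsilon_ratCast q⟩
  have hrank : Module.finrank ℝ (Fin A.natDegree → ℝ) =
      Module.finrank ℝ (mixedEmbedding.mixedSpace K) := by
    rw [Module.finrank_fin_fun, mixedEmbedding.finrank, h.natDegree_eq_finrank]
  exact ⟨(LinearMap.injective_iff_surjective_of_finrank_eq_finrank hrank).2 hsurj, hsurj⟩

theorem exists_fract_sum_param_mul_eq (h0 : A.coeff 0 ≠ 0) (y : Fin A.natDegree → ℤ) :
    ∃ m < (A.coeff 0).natAbs,
      Int.fract (∑ i, param A i * y i) = (m : ℝ) / (A.coeff 0).natAbs := by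
  have hsign : ((A.coeff 0).natAbs : ℝ) = (A.coeff 0).sign * A.coeff 0 := by
    rw [← Int.cast_mul, Int.sign_mul_self, Int.cast_natCast]
  have hsign0 : ((A.coeff 0).sign : ℝ) ≠ 0 :=
    Int.cast_ne_zero.2 (Int.sign_eq_zero_iff_zero.not.2 h0)
  have hsum : ∑ i, param A i * y i =
      (((A.coeff 0).sign * ∑ i : Fin A.natDegree, A.coeff (A.natDegree - i) * y i : ℤ) : ℝ) /
        (A.coeff 0).natAbs := by
    rw [Int.cast_mul, hsign, mul_div_mul_left _ _ hsign0, Int.cast_sum, Finset.sum_div]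
    exact Finset.sum_congr rfl fun i _ => by rw [param, Int.cast_mul, div_mul_eq_mul_div]
  rw [hsum]
  exact exists_fract_intCast_div_natCast_eq _ (Int.natAbs_pos.2 h0)

theorem IsExpandingGenerator.tau_eq_iff_exists_digit (h : IsExpandingGenerator α A)
    {y z : Fin A.natDegree → ℤ} : tau (param A) y = z ↔
      ∃ m < (A.coeff 0).natAbs, latticePoint A α y = α * latticePoint A α z + m := by
  have hpos : (0 : ℝ) < (A.coeff 0).natAbs :=
    Nat.cast_pos.2 (Int.natAbs_pos.2 h.coeff_zero_ne_zero)
  have hshift : ∀ m : ℕ,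
      shift (fun i => (y i : ℝ)) (m / (A.coeff 0).natAbs - ∑ i, param A i * y i) =
        (fun i => (z i : ℝ)) ↔ latticePoint A α y = α * latticePoint A α z + m := by
    intro m
    have hα : IsUnit (mixedEmbedding K α) := h.ne_zero.isUnit.map _
    rw [← h.upsilon_bijective.1.eq_iff, ← hα.mul_right_inj,
      mixedEmbedding_mul_upsilon_shift h.aeval_eq_zero h.coeff_zero_ne_zero, upsilon_intCast,
      upsilon_intCast, add_sub_cancel, mul_div_cancel₀ _ hpos.ne',
      ← (mixedEmbedding_injective K).eq_iff, map_add, map_mul, map_natCast, sub_eq_iff_eq_add,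
      Nat.cast_smul_eq_nsmul, nsmul_one]
  constructor
  · rintro rfl
    obtain ⟨m, hm, hfract⟩ := exists_fract_sum_param_mul_eq h.coeff_zero_ne_zero y
    exact ⟨m, hm, (hshift m).1 (hfract ▸ (intCast_tau _ y).symm)⟩
  · rintro ⟨m, hm, hyz⟩
    exact tau_eq_of_shift_eq ⟨by positivity, (div_lt_one hpos).2 (Nat.cast_lt.2 hm)⟩
      ((hshift m).2 hyz)

end Upsilon

section Hutchinson

open TopologicalSpace
open scoped NNReal

theorem infEDist_image_le {X Y : Type*} [PseudoEMetricSpace X] [PseudoEMetricSpace Y] {c : ℝ≥0}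
    {f : X → Y} (hf : LipschitzWith c f) {t : Set X} (ht : t.Nonempty) (x : X) :
    Metric.infEDist (f x) (f '' t) ≤ c * Metric.infEDist x t := by
  have : Nonempty t := ht.to_subtype
  rw [Metric.infEDist, Metric.infEDist, iInf_image, iInf_subtype', iInf_subtype',
    ENNReal.mul_iInf fun h => absurd h ENNReal.coe_ne_top]
  exact iInf_mono fun y => hf x y

theorem hausdorffEDist_image_le {X Y : Type*} [PseudoEMetricSpace X] [PseudoEMetricSpace Y]
    {c : ℝ≥0} {f : X → Y} (hf : LipschitzWith c f) {s t : Set X} (hs : s.Nonempty)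
    (ht : t.Nonempty) :
    Metric.hausdorffEDist (f '' s) (f '' t) ≤ c * Metric.hausdorffEDist s t := by
  have hbound : ∀ {s t : Set X}, t.Nonempty →
      ∀ y ∈ f '' s, Metric.infEDist y (f '' t) ≤ c * Metric.hausdorffEDist s t := by
    rintro s t ht _ ⟨x, hx, rfl⟩
    exact (infEDist_image_le hf ht x).trans
      (mul_le_mul_right (Metric.infEDist_le_hausdorffEDist_of_mem hx) _)
  exact Metric.hausdorffEDist_le_of_infEDist (hbound ht)
    (Metric.hausdorffEDist_comm (s := s) (t := t) ▸ hbound hs)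

theorem existsUnique_isCompact_eq_iUnion_image {ι X : Type*} [Finite ι] [Nonempty ι]
    [MetricSpace X] [CompleteSpace X] [Nonempty X] {c : ℝ≥0} (hc : c < 1) {f : ι → X → X}
    (hf : ∀ i, LipschitzWith c (f i)) :
    ∃! F : Set X, F.Nonempty ∧ IsCompact F ∧ F = ⋃ i, f i '' F := by
  let H : NonemptyCompacts X → NonemptyCompacts X := fun F =>
    { carrier := ⋃ i, f i '' F
      isCompact' := isCompact_iUnion fun i => F.isCompact.image (hf i).continuous
      nonempty' := Set.nonempty_iUnion.2 ⟨Classical.arbitrary ι, F.nonempty.image _⟩ }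
  have hH : ContractingWith c H := ⟨hc, fun F G => Metric.hausdorffEDist_iUnion_le.trans
    (iSup_le fun i => hausdorffEDist_image_le (hf i) F.nonempty G.nonempty)⟩
  have hiff : ∀ F : NonemptyCompacts X, Function.IsFixedPt H F ↔ (F : Set X) = ⋃ i, f i '' F :=
    fun F => eq_comm.trans SetLike.coe_set_eq.symm
  have : Nonempty (NonemptyCompacts X) := ⟨{Classical.arbitrary X}⟩
  refine ⟨hH.fixedPoint, ⟨NonemptyCompacts.nonempty _, NonemptyCompacts.isCompact _,
    (hiff _).1 hH.fixedPoint_isFixedPt⟩, ?_⟩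
  rintro F ⟨hne, hcpt, hF⟩
  exact congrArg (fun G : NonemptyCompacts X => (G : Set X))
    (hH.fixedPoint_unique ((hiff ⟨⟨F, hcpt⟩, hne⟩).2 hF))

theorem image_mul_eq_iUnion_iff {R ι : Type*} [CommSemiring R] {a b : R} (hab : a * b = 1)
    {d : ι → R} {F : Set R} :
    (fun z => a * z) '' F = ⋃ i, (fun z => z + d i) '' F ↔
      F = ⋃ i, (fun z => b * (z + d i)) '' F := by
  have hinv : ∀ x, b * (a * x) = x := fun x => by rw [← mul_assoc, mul_comm b, hab, one_mul]
  have hinv' : ∀ x, a * (b * x) = x := fun x => by rw [← mul_assoc, hab, one_mul]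
  constructor <;> intro h
  · have := congrArg ((b * ·) '' ·) h
    simpa only [Set.image_image, Set.image_iUnion, hinv, Set.image_id'] using this
  · have := congrArg ((a * ·) '' ·) h
    simpa only [Set.image_image, Set.image_iUnion, hinv'] using this

theorem existsUnique_isCompact_image_mul_eq_iUnion {R ι : Type*} [NormedCommRing R]
    [CompleteSpace R] [Finite ι] [Nonempty ι] {a b : R} (hab : a * b = 1) (hb : ‖b‖ < 1)
    (d : ι → R) :
    ∃! F : Set R, F.Nonempty ∧ IsCompact F ∧
      (fun z => a * z) '' F = ⋃ i, (fun z => z + d i) '' F := by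
  simp only [image_mul_eq_iUnion_iff hab]
  refine existsUnique_isCompact_eq_iUnion_image (c := ‖b‖₊) hb fun i x y => ?_
  rw [edist_eq_enorm_sub, edist_eq_enorm_sub, ← mul_sub, add_sub_add_right_eq_sub]
  exact ENNReal.coe_le_coe.2 (nnnorm_mul_le b (x - y))

end Hutchinson

section Places

variable {K : Type*} [Field K] {A : ℤ[X]} {α : K}

theorem IsExpanding.one_lt_infinitePlace (hexp : IsExpanding A) (hA : aeval α A = 0)
    (v : InfinitePlace K) : 1 < v α := by
  rw [← InfinitePlace.norm_embedding_eq]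
  refine hexp _ ?_
  rw [← map_zero v.embedding, ← hA]
  exact aeval_algHom_apply v.embedding.toIntAlgHom α A

theorem biUnion_digitSet {X : Type*} (s : K → Set X) :
    ⋃ d ∈ digitSet A K, s d = ⋃ i : Fin (A.coeff 0).natAbs, s (i : ℕ) := by
  ext x
  simp only [digitSet, Set.mem_ofPred_eq, Set.mem_iUnion, Fin.exists_iff, exists_prop]
  exact ⟨fun ⟨_, ⟨m, hm, rfl⟩, hx⟩ => ⟨m, hm, hx⟩, fun ⟨m, hm, hx⟩ => ⟨_, ⟨m, hm, rfl⟩, hx⟩⟩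

variable [NumberField K] {𝔞 𝔟 : Ideal (𝓞 K)}

/-- `𝔟` has as prime divisors exactly the poles of `α`, as the denominator of `α𝓞` does. Only
these prime divisors enter in `K_𝔟`. -/
structure IsPoleIdeal (α : K) (𝔟 : Ideal (𝓞 K)) : Prop where
  ne_bot : 𝔟 ≠ ⊥
  dvd_iff : ∀ v : HeightOneSpectrum (𝓞 K), v.asIdeal ∣ 𝔟 ↔ 1 < v.valuation K α

theorem mul_algebraMap_mem_of_mem (hα : FractionalIdeal.spanSingleton (nonZeroDivisors (𝓞 K)) α *
      (𝔟 : FractionalIdeal (nonZeroDivisors (𝓞 K)) K) = 𝔞) {s : 𝓞 K} (hs : s ∈ 𝔟) :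
    ∃ t ∈ 𝔞, algebraMap (𝓞 K) K t = α * algebraMap (𝓞 K) K s := by
  have hmem : α * algebraMap (𝓞 K) K s ∈ (𝔞 : FractionalIdeal (nonZeroDivisors (𝓞 K)) K) := by
    rw [← hα, FractionalIdeal.mem_singleton_mul]
    exact ⟨_, FractionalIdeal.mem_coeIdeal_of_mem _ hs, rfl⟩
  exact (FractionalIdeal.mem_coeIdeal _).1 hmem

theorem exists_algebraMap_eq_mul_of_mem
    (hα : FractionalIdeal.spanSingleton (nonZeroDivisors (𝓞 K)) α *
      (𝔟 : FractionalIdeal (nonZeroDivisors (𝓞 K)) K) = 𝔞) {t : 𝓞 K} (ht : t ∈ 𝔞) :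
    ∃ s ∈ 𝔟, algebraMap (𝓞 K) K t = α * algebraMap (𝓞 K) K s := by
  have hmem : algebraMap (𝓞 K) K t ∈ (𝔞 : FractionalIdeal (nonZeroDivisors (𝓞 K)) K) :=
    FractionalIdeal.mem_coeIdeal_of_mem _ ht
  rw [← hα, FractionalIdeal.mem_singleton_mul] at hmem
  obtain ⟨y, hy, hty⟩ := hmem
  obtain ⟨s, hs, rfl⟩ := (FractionalIdeal.mem_coeIdeal _).1 hy
  exact ⟨s, hs, hty⟩

theorem isPoleIdeal_of_spanSingleton_mul (hcop : 𝔞 ⊔ 𝔟 = ⊤)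
    (hα : FractionalIdeal.spanSingleton (nonZeroDivisors (𝓞 K)) α *
      (𝔟 : FractionalIdeal (nonZeroDivisors (𝓞 K)) K) = 𝔞) : IsPoleIdeal α 𝔟 := by
  refine ⟨?_, fun v => ?_⟩
  · rintro rfl
    rw [FractionalIdeal.coeIdeal_bot, mul_zero, eq_comm, FractionalIdeal.coeIdeal_eq_zero] at hα
    exact bot_ne_top (by rwa [hα, sup_bot_eq] at hcop)
  constructor
  · intro hv
    have hb := Ideal.le_of_dvd hv
    have ha : ¬ 𝔞 ≤ v.asIdeal := fun h => v.isPrime.ne_top (top_le_iff.1 (hcop ▸ sup_le h hb))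
    obtain ⟨t, ht, htv⟩ := Set.not_subset.1 ha
    obtain ⟨s, hs, hts⟩ := exists_algebraMap_eq_mul_of_mem hα ht
    have hvt := (v.valuation_eq_one_iff_notMem (K := K)).2 htv
    have hvs := (v.valuation_lt_one_iff_mem (K := K) s).2 (hb hs)
    rw [hts, map_mul] at hvt
    exact lt_of_not_ge fun hle => ((mul_le_of_le_one_left' hle).trans_lt hvs).ne hvt
  · intro hv
    by_contra hndvd
    obtain ⟨s, hs, hsv⟩ := Set.not_subset.1 (mt Ideal.dvd_iff_le.2 hndvd)
    obtain ⟨t, -, hts⟩ := mul_algebraMap_mem_of_mem hα hs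
    have hvs := (v.valuation_eq_one_iff_notMem (K := K)).2 hsv
    have hvt : v.valuation K (algebraMap (𝓞 K) K t) ≤ 1 := v.valuation_le_one t
    rw [hts, map_mul, hvs, mul_one] at hvt
    exact hv.not_ge hvt

theorem IsPoleIdeal.finite (h : IsPoleIdeal α 𝔟) :
    Finite {v : HeightOneSpectrum (𝓞 K) // v.asIdeal ∣ 𝔟} :=
  (Ideal.finite_factors h.ne_bot).to_subtype

theorem valuation_le_one_of_mem_adjoin {R L Γ : Type*} [CommRing R] [Field L] [Algebra R L]
    [LinearOrderedCommGroupWithZero Γ] (v : Valuation L Γ) (hv : ∀ r : R, v (algebraMap R L r) ≤ 1)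
    {β x : L} (hβ : v β ≤ 1) (hx : x ∈ Algebra.adjoin R {β}) : v x ≤ 1 := by
  induction hx using Algebra.adjoin_induction with
  | mem x hx => rwa [Set.mem_singleton_iff.1 hx]
  | algebraMap r => exact hv r
  | add x y _ _ hx hy => exact v.map_add_le hx hy
  | mul x y _ _ hx hy => exact map_mul v x y ▸ mul_le_one' hx hy

theorem valuation_intCast_le_one (v : HeightOneSpectrum (𝓞 K)) (m : ℤ) :
    v.valuation K (algebraMap ℤ K m) ≤ 1 := by
  simpa using v.valuation_le_one (K := K) (m : 𝓞 K)

theorem norm_algebraMap_le_one_iff (v : HeightOneSpectrum (𝓞 K)) (x : K) :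
    ‖algebraMap K (v.adicCompletion K) x‖ ≤ 1 ↔ v.valuation K x ≤ 1 := by
  have h : Valued.v (algebraMap K (v.adicCompletion K) x) = v.valuation K x :=
    v.valuedAdicCompletion_eq_valuation' x
  rw [Valued.toNormedField.norm_le_one_iff, h]

theorem IsPoleIdeal.one_lt_norm_algebraMap (h : IsPoleIdeal α 𝔟) {v : HeightOneSpectrum (𝓞 K)}
    (hv : v.asIdeal ∣ 𝔟) : 1 < ‖algebraMap K (v.adicCompletion K) α‖ :=
  lt_of_not_ge fun hle => ((h.dvd_iff v).1 hv).not_ge ((norm_algebraMap_le_one_iff v α).1 hle)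

open Classical in
theorem norm_mixedEmbedding_inv_lt_one (hα : ∀ v : InfinitePlace K, 1 < v α) :
    ‖mixedEmbedding K α⁻¹‖ < 1 := by
  rw [Prod.norm_def, max_lt_iff, pi_norm_lt_iff one_pos, pi_norm_lt_iff one_pos]
  refine ⟨fun v => ?_, fun v => ?_⟩
  · change ‖InfinitePlace.embedding_of_isReal v.2 α⁻¹‖ < 1
    rw [InfinitePlace.norm_embedding_of_isReal, map_inv₀]
    exact inv_lt_one_of_one_lt₀ (hα v.1)
  · change ‖v.1.embedding α⁻¹‖ < 1
    rw [InfinitePlace.norm_embedding_eq, map_inv₀]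
    exact inv_lt_one_of_one_lt₀ (hα v.1)

theorem tendsto_mixedEmbedding_inv_pow (hα : ∀ v : InfinitePlace K, 1 < v α) :
    Tendsto (fun k => mixedEmbedding K α⁻¹ ^ k) atTop (𝓝 0) := by
  classical
  exact tendsto_pow_atTop_nhds_zero_of_norm_lt_one (norm_mixedEmbedding_inv_lt_one hα)

open Classical in
theorem IsPoleIdeal.norm_Phi_inv_lt_one
    [Fintype {v : HeightOneSpectrum (𝓞 K) // v.asIdeal ∣ 𝔟}] (h : IsPoleIdeal α 𝔟)
    (hα : ∀ v : InfinitePlace K, 1 < v α) : ‖Phi 𝔟 α⁻¹‖ < 1 := by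
  rw [Prod.norm_def, max_lt_iff, pi_norm_lt_iff one_pos]
  refine ⟨norm_mixedEmbedding_inv_lt_one hα, fun v => ?_⟩
  change ‖algebraMap K (v.1.adicCompletion K) α⁻¹‖ < 1
  rw [map_inv₀, norm_inv]
  exact inv_lt_one_of_one_lt₀ (h.one_lt_norm_algebraMap v.2)

theorem IsPoleIdeal.existsUnique_isSelfAffineTile (h : IsPoleIdeal α 𝔟)
    (hα : ∀ v : InfinitePlace K, 1 < v α) (hα0 : α ≠ 0) (h0 : A.coeff 0 ≠ 0) :
    ∃! F : Set (RepSpace K 𝔟), IsSelfAffineTile α 𝔟 (digitSet A K) F := by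
  classical
  have := h.finite
  have := Fintype.ofFinite {v : HeightOneSpectrum (𝓞 K) // v.asIdeal ∣ 𝔟}
  have : Nonempty (Fin (A.coeff 0).natAbs) := Fin.pos_iff_nonempty.1 (Int.natAbs_pos.2 h0)
  have hunit : Phi 𝔟 α * Phi 𝔟 α⁻¹ = 1 := by rw [← map_mul, mul_inv_cancel₀ hα0, map_one]
  have hdigit := fun F : Set (RepSpace K 𝔟) =>
    biUnion_digitSet (A := A) fun d => (fun z => z + Phi 𝔟 d) '' F
  obtain ⟨F, ⟨hne, hcpt, heq⟩, huniq⟩ := existsUnique_isCompact_image_mul_eq_iUnion hunit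
    (h.norm_Phi_inv_lt_one hα) fun i : Fin (A.coeff 0).natAbs => Phi 𝔟 ((i : ℕ) : K)
  exact ⟨F, ⟨hne, hcpt, heq.trans (hdigit F).symm⟩, fun G hG =>
    huniq G ⟨hG.nonempty, hG.isCompact, hG.set_eq.trans (hdigit G)⟩⟩

end Places

section AdjoinInv

variable {R L : Type*} [CommRing R] [Field L] [Algebra R L] {α : L}

theorem eventually_inv_pow_mul_mem_adjoin (hα : α ≠ 0) {x : L} (hx : x ∈ Algebra.adjoin R {α}) :
    ∀ᶠ m : ℕ in atTop, α⁻¹ ^ m * x ∈ Algebra.adjoin R {α⁻¹} := by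
  obtain ⟨P, rfl⟩ := Algebra.adjoin_singleton_eq_range_aeval R α ▸ hx
  have hmem : α⁻¹ ^ P.natDegree * aeval α P ∈ Algebra.adjoin R {α⁻¹} := by
    have hrev := aeval_reverse (inv_ne_zero hα) P
    rw [inv_inv] at hrev
    exact hrev ▸ aeval_mem_adjoin_singleton R α⁻¹
  refine eventually_atTop.2 ⟨P.natDegree, fun m hm => ?_⟩
  rw [← Nat.sub_add_cancel hm, pow_add, mul_assoc]
  exact mul_mem (pow_mem (Algebra.self_mem_adjoin_singleton R _) _) hmem

theorem exists_forall_inv_pow_mul_mem_adjoin (hα : α ≠ 0) {N : Submodule R L} (hN : N.FG)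
    (hle : N ≤ (Algebra.adjoin R {α}).toSubmodule) :
    ∃ m : ℕ, ∀ x ∈ N, α⁻¹ ^ m * x ∈ Algebra.adjoin R {α⁻¹} := by
  obtain ⟨s, rfl⟩ := hN
  obtain ⟨m, hm⟩ := ((eventually_all_finset s).2 fun x hx =>
    eventually_inv_pow_mul_mem_adjoin hα (hle (Submodule.subset_span hx))).exists
  have hspan : Submodule.span R s ≤
      (Algebra.adjoin R {α⁻¹}).toSubmodule.comap (LinearMap.mulLeft R (α⁻¹ ^ m)) :=
    Submodule.span_le.2 hm
  exact ⟨m, fun x hx => hspan hx⟩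

end AdjoinInv

section Ultrametric

/-- Expansion by `a` pushes a point of maximal norm out of `S`, unless it stays in the unit ball. -/
theorem norm_mul_le_one_of_isCompact {L : Type*} [NormedField L] [IsUltrametricDist L] {a : L}
    (ha : 1 < ‖a‖) {S : Set L} (hS : IsCompact S) (h : ∀ s ∈ S, ∃ t ∈ S, ‖a * s - t‖ ≤ 1) {s : L}
    (hs : s ∈ S) : ‖a * s‖ ≤ 1 := by
  obtain ⟨t, ht, hmax⟩ := hS.exists_isMaxOn ⟨s, hs⟩ continuous_norm.continuousOn
  have hle : ‖a * s‖ ≤ ‖a * t‖ := by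
    rw [norm_mul, norm_mul]
    exact mul_le_mul_of_nonneg_left (hmax hs) (norm_nonneg a)
  refine hle.trans (not_lt.1 fun hlt => ?_)
  obtain ⟨u, hu, hdist⟩ := h t ht
  have hau : ‖a * t‖ ≤ ‖u‖ := by
    have hultra := IsUltrametricDist.norm_add_le_max (a * t - u) u
    rw [sub_add_cancel] at hultra
    exact (le_max_iff.1 hultra).resolve_left fun hle => (hle.trans hdist).not_gt hlt
  have htpos : 0 < ‖t‖ := norm_pos_iff.2 fun h0 => by
    rw [h0, mul_zero, norm_zero] at hlt
    exact zero_lt_one.not_gt hlt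
  have hat : ‖a * t‖ ≤ 1 * ‖t‖ := by
    rw [one_mul]
    exact hau.trans (hmax hu)
  rw [norm_mul] at hat
  exact ha.not_ge (le_of_mul_le_mul_right hat htpos)

end Ultrametric

section IntersectiveTiles

variable {K : Type*} [Field K] [NumberField K] {A : ℤ[X]} {α x : K} {𝔟 : Ideal (𝓞 K)}
  {F : Set (RepSpace K 𝔟)}

theorem mem_intersectiveTile_iff {g : mixedEmbedding.mixedSpace K} :
    g ∈ intersectiveTile F x ↔ ((g, 0) : RepSpace K 𝔟) - Phi 𝔟 x ∈ F := by
  rw [intersectiveTile, Set.mem_ofPred_eq, Set.image_add_right, Set.mem_preimage, sub_eq_add_neg]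

theorem IsSelfAffineTile.isCompact_intersectiveTile {D : Set K} (hF : IsSelfAffineTile α 𝔟 D F)
    (x : K) : IsCompact (intersectiveTile F x) := by
  have hfst : intersectiveTile F x =
      Prod.fst '' ((fun z => z + Phi 𝔟 x) '' F ∩ Prod.snd ⁻¹' {0}) := by
    ext g
    constructor
    · exact fun hg => ⟨(g, 0), ⟨hg, rfl⟩, rfl⟩
    · rintro ⟨⟨g, u⟩, ⟨hp, hu⟩, rfl⟩
      obtain rfl : u = 0 := hu
      exact hp
  rw [hfst]
  exact ((hF.isCompact.image (continuous_add_const _)).inter_right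
    (isClosed_singleton.preimage continuous_snd)).image continuous_fst

namespace IsSelfAffineTile

theorem mem_iff (hF : IsSelfAffineTile α 𝔟 (digitSet A K) F) (hα : α ≠ 0) {p : RepSpace K 𝔟} :
    p ∈ F ↔ ∃ m < (A.coeff 0).natAbs, Phi 𝔟 α * p - Phi 𝔟 m ∈ F := by
  have hunit : IsUnit (Phi 𝔟 α) := hα.isUnit.map _
  rw [← hunit.mul_right_injective.mem_set_image (s := F), hF.set_eq,
    biUnion_digitSet fun d => (fun z => z + Phi 𝔟 d) '' F]
  simp only [Set.mem_iUnion, Fin.exists_iff, Set.image_add_right, Set.mem_preimage,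
    sub_eq_add_neg, exists_prop]

theorem sub_Phi_mem_iff (hF : IsSelfAffineTile α 𝔟 (digitSet A K) F) (hα : α ≠ 0)
    {p : RepSpace K 𝔟} : p - Phi 𝔟 x ∈ F ↔
      ∃ m < (A.coeff 0).natAbs, Phi 𝔟 α * p - Phi 𝔟 (α * x + m) ∈ F := by
  rw [hF.mem_iff hα]
  simp only [mul_sub, map_add, map_mul, sub_sub]

theorem mem_intersectiveTile_iff_exists_digit (hF : IsSelfAffineTile α 𝔟 (digitSet A K) F)
    (hα : α ≠ 0) {g : mixedEmbedding.mixedSpace K} : g ∈ intersectiveTile F x ↔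
      ∃ m < (A.coeff 0).natAbs, mixedEmbedding K α * g ∈ intersectiveTile F (α * x + m) := by
  have hmul : Phi 𝔟 α * ((g, 0) : RepSpace K 𝔟) = (mixedEmbedding K α * g, 0) :=
    Prod.ext rfl (mul_zero _)
  rw [mem_intersectiveTile_iff, hF.sub_Phi_mem_iff hα, hmul]
  simp only [mem_intersectiveTile_iff]

theorem norm_mul_snd_le_one (hF : IsSelfAffineTile α 𝔟 (digitSet A K) F) (h𝔟 : IsPoleIdeal α 𝔟)
    (hα : α ≠ 0) {f : RepSpace K 𝔟} (hf : f ∈ F)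
    (v : {v : HeightOneSpectrum (𝓞 K) // v.asIdeal ∣ 𝔟}) :
    ‖algebraMap K (v.1.adicCompletion K) α * f.2 v‖ ≤ 1 := by
  have hcont : Continuous fun f : RepSpace K 𝔟 => f.2 v := (continuous_apply v).comp continuous_snd
  refine norm_mul_le_one_of_isCompact (h𝔟.one_lt_norm_algebraMap v.2) (hF.isCompact.image hcont) ?_
    (Set.mem_image_of_mem _ hf)
  rintro _ ⟨f, hf, rfl⟩
  obtain ⟨m, -, hm⟩ := (hF.mem_iff hα).1 hf
  refine ⟨_, Set.mem_image_of_mem _ hm, ?_⟩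
  have hsub : algebraMap K (v.1.adicCompletion K) α * f.2 v - (Phi 𝔟 α * f - Phi 𝔟 m).2 v =
      algebraMap K (v.1.adicCompletion K) m := sub_sub_cancel _ _
  rw [hsub, norm_algebraMap_le_one_iff]
  simpa using valuation_intCast_le_one v.1 m

theorem mul_mem_range_of_nonempty (hF : IsSelfAffineTile α 𝔟 (digitSet A K) F)
    (h𝔟 : IsPoleIdeal α 𝔟) (hα : α ≠ 0) (hx : x ∈ Algebra.adjoin ℤ {α})
    (hne : (intersectiveTile F x).Nonempty) : α * x ∈ (algebraMap (𝓞 K) K).range := by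
  refine HeightOneSpectrum.mem_integers_of_valuation_le_one K _ fun v => ?_
  by_cases hv : v.asIdeal ∣ 𝔟
  · obtain ⟨g, hg⟩ := hne
    have hnorm := hF.norm_mul_snd_le_one h𝔟 hα (mem_intersectiveTile_iff.1 hg) ⟨v, hv⟩
    have hsnd : (((g, 0) : RepSpace K 𝔟) - Phi 𝔟 x).2 ⟨v, hv⟩ =
        -algebraMap K (v.adicCompletion K) x := zero_sub _
    rwa [hsnd, mul_neg, norm_neg, ← map_mul, norm_algebraMap_le_one_iff] at hnorm
  · exact valuation_le_one_of_mem_adjoin (R := ℤ) _ (valuation_intCast_le_one v)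
      (not_lt.1 (mt (h𝔟.dvd_iff v).2 hv))
      (mul_mem (Algebra.self_mem_adjoin_singleton ℤ α) hx)

theorem exists_forall_inv_pow_mul_mem_adjoin_of_nonempty
    (hF : IsSelfAffineTile α 𝔟 (digitSet A K) F) (h𝔟 : IsPoleIdeal α 𝔟) (hα : α ≠ 0) :
    ∃ m : ℕ, ∀ x ∈ Algebra.adjoin ℤ {α}, (intersectiveTile F x).Nonempty →
      α⁻¹ ^ m * (α * x) ∈ Algebra.adjoin ℤ {α⁻¹} := by
  let O : Submodule ℤ K := LinearMap.range (Algebra.linearMap (𝓞 K) K |>.restrictScalars ℤ)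
  have hfg : (O ⊓ (Algebra.adjoin ℤ {α}).toSubmodule).FG :=
    isNoetherian_submodule.1 (inferInstance : IsNoetherian ℤ O) _ inf_le_left
  obtain ⟨m, hm⟩ := exists_forall_inv_pow_mul_mem_adjoin hα hfg inf_le_right
  exact ⟨m, fun x hx hne => hm _ ⟨hF.mul_mem_range_of_nonempty h𝔟 hα hx hne,
    Subalgebra.mul_mem _ (Algebra.self_mem_adjoin_singleton ℤ α) hx⟩⟩

theorem mem_lamZero_of_nonempty (hF : IsSelfAffineTile α 𝔟 (digitSet A K) F)
    (h𝔟 : IsPoleIdeal α 𝔟) (hα : α ≠ 0) (hx : x ∈ Algebra.adjoin ℤ {α})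
    (hne : (intersectiveTile F x).Nonempty) : x ∈ lamZero α := by
  have hself {β : K} : β ∈ Algebra.adjoin ℤ {β} := Algebra.self_mem_adjoin_singleton ℤ β
  obtain ⟨m, hm⟩ := hF.exists_forall_inv_pow_mul_mem_adjoin_of_nonempty h𝔟 hα
  -- Passing from `y` to a successor `α y + d` whose tile is non-empty lowers the exponent by one.
  induction m with
  | zero => exact mem_lamZero.2 ⟨hx, by simpa using hm x hx hne⟩
  | succ m ih =>
    refine ih fun y hy ⟨g, hg⟩ => ?_
    obtain ⟨d, -, hd⟩ := (hF.mem_intersectiveTile_iff_exists_digit hα).1 hg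
    have hsucc := hm (α * y + d) (add_mem (mul_mem hself hy) (natCast_mem _ d)) ⟨_, hd⟩
    have hsub : α⁻¹ ^ m * (α * y) = α⁻¹ ^ (m + 1) * (α * (α * y + d)) - α⁻¹ ^ m * d := by
      rw [pow_succ, mul_assoc, inv_mul_cancel_left₀ hα, mul_add, add_sub_cancel_right]
    exact hsub ▸ sub_mem hsucc (mul_mem (pow_mem hself _) (natCast_mem _ d))

end IsSelfAffineTile

theorem IsPoleIdeal.norm_algebraMap_le_one_of_mem_lamZero (h𝔟 : IsPoleIdeal α 𝔟)
    (hx : x ∈ lamZero α) {v : HeightOneSpectrum (𝓞 K)} (hv : v.asIdeal ∣ 𝔟) :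
    ‖algebraMap K (v.adicCompletion K) x‖ ≤ 1 := by
  have hα := (h𝔟.dvd_iff v).1 hv
  have hinv : v.valuation K α⁻¹ ≤ 1 := map_inv₀ (v.valuation K) α ▸ (inv_lt_one_of_one_lt₀ hα).le
  have hmul := valuation_le_one_of_mem_adjoin (R := ℤ) _ (valuation_intCast_le_one v) hinv
    (mem_lamZero.1 hx).2
  rw [map_mul] at hmul
  rw [norm_algebraMap_le_one_iff]
  exact not_lt.1 fun hlt => hmul.not_gt (one_lt_mul'' hα hlt)

end IntersectiveTiles

namespace IsExpandingGenerator

variable {K : Type*} [Field K] [NumberField K] {A : ℤ[X]} {α : K} {𝔟 : Ideal (𝓞 K)}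
  {F : Set (RepSpace K 𝔟)}

theorem tau_param_surjective (h : IsExpandingGenerator α A) :
    Function.Surjective (tau (param A)) := by
  have : NeZero A.natDegree := ⟨h.natDegree_pos.ne'⟩
  have hparam : param A 0 = A.leadingCoeff / A.coeff 0 := rfl
  have hlead : (A.leadingCoeff : ℝ) ≠ 0 := h.isPrimitiveMinpoly.leadingCoeff_cast_ne_zero
  refine tau_surjective (hparam ▸ div_ne_zero hlead (Int.cast_ne_zero.2 h.coeff_zero_ne_zero)) ?_
  rw [hparam, abs_div]
  exact div_le_one_of_le₀ (mod_cast h.isExpanding.abs_leadingCoeff_le) (abs_nonneg _)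

theorem latticePoint_mem_lamZero (h : IsExpandingGenerator α A) (z : Fin A.natDegree → ℤ) :
    latticePoint A α z ∈ lamZero α :=
  (h.isPrimitiveMinpoly.mem_lamZero_iff_exists_latticePoint h.coeff_zero_ne_zero).2 ⟨z, rfl⟩

theorem sub_Phi_iterate_tau_mem (h : IsExpandingGenerator α A)
    (hF : IsSelfAffineTile α 𝔟 (digitSet A K) F) {p : RepSpace K 𝔟} {y : Fin A.natDegree → ℤ}
    (hp : p - Phi 𝔟 (latticePoint A α y) ∈ F) (k : ℕ) :
    Phi 𝔟 α⁻¹ ^ k * p - Phi 𝔟 (latticePoint A α ((tau (param A))^[k] y)) ∈ F := by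
  induction k with
  | zero => rwa [pow_zero, one_mul, Function.iterate_zero_apply]
  | succ k ih =>
    obtain ⟨m, hm, hy⟩ := h.tau_eq_iff_exists_digit.1
      (Function.iterate_succ_apply' (tau (param A)) k y).symm
    refine (hF.sub_Phi_mem_iff h.ne_zero).2 ⟨m, hm, ?_⟩
    rwa [← hy, pow_succ', mul_assoc, ← mul_assoc, ← map_mul, mul_inv_cancel₀ h.ne_zero, map_one,
      one_mul]

theorem tendsto_Phi_inv_pow_mul_snd (h : IsExpandingGenerator α A) (h𝔟 : IsPoleIdeal α 𝔟)
    (f : RepSpace K 𝔟) (y : ℕ → Fin A.natDegree → ℤ) :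
    Tendsto (fun k => (Phi 𝔟 α⁻¹ ^ k * (f + Phi 𝔟 (latticePoint A α (y k)))).2) atTop (𝓝 0) := by
  refine tendsto_pi_nhds.2 fun v => ?_
  have hpow : Tendsto (fun k => algebraMap K (v.1.adicCompletion K) α⁻¹ ^ k) atTop (𝓝 0) := by
    refine tendsto_pow_atTop_nhds_zero_of_norm_lt_one ?_
    rw [map_inv₀, norm_inv]
    exact inv_lt_one_of_one_lt₀ (h𝔟.one_lt_norm_algebraMap v.2)
  refine hpow.zero_mul_isBoundedUnder_le (isBoundedUnder_of ⟨‖f.2 v‖ + 1, fun k => ?_⟩)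
  exact (norm_add_le _ _).trans (add_le_add le_rfl
    (h𝔟.norm_algebraMap_le_one_of_mem_lamZero (h.latticePoint_mem_lamZero (y k)) v.2))

theorem nonempty_intersectiveTile (h : IsExpandingGenerator α A) (h𝔟 : IsPoleIdeal α 𝔟)
    (hF : IsSelfAffineTile α 𝔟 (digitSet A K) F) (z : Fin A.natDegree → ℤ) :
    (intersectiveTile F (latticePoint A α z)).Nonempty := by
  obtain ⟨f, hf⟩ := hF.nonempty
  choose y hy using fun k => (h.tau_param_surjective.iterate k) z
  have hmem : ∀ k, Phi 𝔟 α⁻¹ ^ k * (f + Phi 𝔟 (latticePoint A α (y k))) -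
      Phi 𝔟 (latticePoint A α z) ∈ F := fun k => by
    rw [← hy k]
    exact h.sub_Phi_iterate_tau_mem hF ((add_sub_cancel_right f _).symm ▸ hf) k
  have hlim := (h.tendsto_Phi_inv_pow_mul_snd h𝔟 f y).sub_const (Phi 𝔟 (latticePoint A α z)).2
  obtain ⟨p, hp, hsnd⟩ := (hF.isCompact.image continuous_snd).isClosed.mem_of_tendsto hlim
    (Eventually.of_forall fun k => ⟨_, hmem k, rfl⟩)
  refine ⟨p.1 + mixedEmbedding K (latticePoint A α z), mem_intersectiveTile_iff.2 ?_⟩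
  convert hp using 1
  exact Prod.ext (add_sub_cancel_right _ _) hsnd.symm

theorem mem_intersectiveTile_latticePoint_iff (h : IsExpandingGenerator α A)
    (h𝔟 : IsPoleIdeal α 𝔟) (hF : IsSelfAffineTile α 𝔟 (digitSet A K) F)
    {z : Fin A.natDegree → ℤ} {g : mixedEmbedding.mixedSpace K} :
    g ∈ intersectiveTile F (latticePoint A α z) ↔ ∃ y, tau (param A) y = z ∧
      mixedEmbedding K α * g ∈ intersectiveTile F (latticePoint A α y) := by
  rw [hF.mem_intersectiveTile_iff_exists_digit h.ne_zero]
  constructor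
  · rintro ⟨m, hm, hg⟩
    have hz := (mem_lamZero.1 (h.latticePoint_mem_lamZero z)).1
    have hmem := hF.mem_lamZero_of_nonempty h𝔟 h.ne_zero (add_mem
      (mul_mem (Algebra.self_mem_adjoin_singleton ℤ α) hz) (natCast_mem _ m)) ⟨_, hg⟩
    obtain ⟨y, hy⟩ := (h.isPrimitiveMinpoly.mem_lamZero_iff_exists_latticePoint
      h.coeff_zero_ne_zero).1 hmem
    exact ⟨y, h.tau_eq_iff_exists_digit.2 ⟨m, hm, hy⟩, hy ▸ hg⟩
  · rintro ⟨y, hy, hg⟩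
    obtain ⟨m, hm, hyz⟩ := h.tau_eq_iff_exists_digit.1 hy
    exact ⟨m, hm, hyz ▸ hg⟩

/-- `Υ` as an isomorphism of topological vector spaces. -/
def upsilonEquiv (h : IsExpandingGenerator α A) :
    (Fin A.natDegree → ℝ) ≃L[ℝ] mixedEmbedding.mixedSpace K :=
  (LinearEquiv.ofBijective (upsilon A α) h.upsilon_bijective).toContinuousLinearEquiv

theorem upsilonEquiv_apply (h : IsExpandingGenerator α A) (x : Fin A.natDegree → ℝ) :
    h.upsilonEquiv x = upsilon A α x :=
  rfl

theorem upsilon_companion_mulVec_eq_iff (h : IsExpandingGenerator α A)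
    {x u : Fin A.natDegree → ℝ} : (companion (param A)).mulVec u = x ↔
      upsilon A α u = mixedEmbedding K α * upsilon A α x := by
  have hα : IsUnit (mixedEmbedding K α) := h.ne_zero.isUnit.map _
  rw [← h.upsilon_bijective.1.eq_iff, ← hα.mul_right_inj,
    mixedEmbedding_mul_upsilon_companion h.aeval_eq_zero h.coeff_zero_ne_zero]

theorem upsilon_companion_pow_mulVec (h : IsExpandingGenerator α A) (k : ℕ)
    (x : Fin A.natDegree → ℝ) : upsilon A α ((companion (param A) ^ k).mulVec x) =
      mixedEmbedding K α⁻¹ ^ k * upsilon A α x := by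
  induction k with
  | zero => rw [pow_zero, pow_zero, Matrix.one_mulVec, one_mul]
  | succ k ih =>
    have hstep : ∀ u, upsilon A α ((companion (param A)).mulVec u) =
        mixedEmbedding K α⁻¹ * upsilon A α u := fun u => by
      rw [(h.upsilon_companion_mulVec_eq_iff (u := u)).1 rfl, ← mul_assoc, ← map_mul,
        inv_mul_cancel₀ h.ne_zero, map_one, one_mul]
    rw [pow_succ', pow_succ', mul_assoc, ← ih, ← Matrix.mulVec_mulVec, hstep]

theorem tendsto_companion_pow (h : IsExpandingGenerator α A) :
    Tendsto (fun k => companion (param A) ^ k) atTop (𝓝 0) := by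
  have hpow := tendsto_mixedEmbedding_inv_pow
    (h.isExpanding.one_lt_infinitePlace h.aeval_eq_zero)
  have hvec : ∀ x, Tendsto (fun k => (companion (param A) ^ k).mulVec x) atTop (𝓝 0) := by
    intro x
    have hlim := (h.upsilonEquiv.symm.continuous.tendsto _).comp (hpow.mul_const (upsilon A α x))
    rw [zero_mul, map_zero] at hlim
    refine hlim.congr fun k => ?_
    rw [Function.comp_apply, ← h.upsilon_companion_pow_mulVec, ← h.upsilonEquiv_apply,
      ContinuousLinearEquiv.symm_apply_apply]
  refine tendsto_pi_nhds.2 fun i => tendsto_pi_nhds.2 fun j => ?_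
  refine (tendsto_pi_nhds.1 (hvec (Pi.single j 1)) i).congr fun k => ?_
  rw [Matrix.mulVec_single_one, Matrix.col_apply]

theorem upsilon_preimage_intersectiveTile_eq_iUnion (h : IsExpandingGenerator α A)
    (h𝔟 : IsPoleIdeal α 𝔟) (hF : IsSelfAffineTile α 𝔟 (digitSet A K) F)
    (z : Fin A.natDegree → ℤ) : upsilon A α ⁻¹' intersectiveTile F (latticePoint A α z) =
      ⋃ (y) (_ : tau (param A) y = z), (companion (param A)).mulVec ''
        (upsilon A α ⁻¹' intersectiveTile F (latticePoint A α y)) := by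
  ext x
  simp only [Set.mem_preimage, h.mem_intersectiveTile_latticePoint_iff h𝔟 hF (z := z),
    Set.mem_iUnion, Set.mem_image, h.upsilon_companion_mulVec_eq_iff, exists_prop]
  refine exists_congr fun y => and_congr_right fun _ => ⟨fun hx => ?_, ?_⟩
  · obtain ⟨u, hu⟩ := h.upsilon_bijective.2 (mixedEmbedding K α * upsilon A α x)
    exact ⟨u, hu ▸ hx, hu⟩
  · rintro ⟨u, hu, hux⟩
    exact hux ▸ hu

theorem exists_norm_intCast_sub_le (h : IsExpandingGenerator α A) (hF : IsCompact F) :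
    ∃ C, ∀ z, ∀ x ∈ upsilon A α ⁻¹' intersectiveTile F (latticePoint A α z),
      ‖(fun i => (z i : ℝ)) - x‖ ≤ C := by
  obtain ⟨C, hC⟩ := ((hF.image continuous_fst).image
    h.upsilonEquiv.symm.continuous).isBounded.exists_norm_le
  refine ⟨C, fun z x hx => ?_⟩
  rw [norm_sub_rev]
  refine hC _ ⟨_, ⟨_, mem_intersectiveTile_iff.1 hx, rfl⟩, ?_⟩
  rw [ContinuousLinearEquiv.symm_apply_eq, upsilonEquiv_apply, map_sub, upsilon_intCast]
  rfl

theorem isSRSTile_upsilon_preimage (h : IsExpandingGenerator α A) (h𝔟 : IsPoleIdeal α 𝔟)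
    (hF : IsSelfAffineTile α 𝔟 (digitSet A K) F) (z : Fin A.natDegree → ℤ) :
    IsSRSTile (param A) z (upsilon A α ⁻¹' intersectiveTile F (latticePoint A α z)) := by
  obtain ⟨C, hC⟩ := h.exists_norm_intCast_sub_le hF.isCompact
  exact isSRSTile_of_eq_iUnion_image (h.upsilon_preimage_intersectiveTile_eq_iUnion h𝔟 hF)
    (fun y => (h.nonempty_intersectiveTile h𝔟 hF y).preimage h.upsilon_bijective.2)
    (fun y => h.upsilonEquiv.toHomeomorph.isCompact_preimage.2
      (hF.isCompact_intersectiveTile (latticePoint A α y))) hC h.tendsto_companion_pow z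

theorem intersectiveTile_eq_upsilon_image (h : IsExpandingGenerator α A) (h𝔟 : IsPoleIdeal α 𝔟)
    (hF : IsSelfAffineTile α 𝔟 (digitSet A K) F) {z : Fin A.natDegree → ℤ}
    {T : Set (Fin A.natDegree → ℝ)} (hT : IsSRSTile (param A) z T) :
    intersectiveTile F (latticePoint A α z) = upsilon A α '' T := by
  rw [hT.unique (h.isSRSTile_upsilon_preimage h𝔟 hF z),
    Set.image_preimage_eq _ h.upsilon_bijective.2]

end IsExpandingGenerator

end RationalTile

end

theorem mainTheorem8 {K : Type*} [Field K] [NumberField K] (α : K) (A : Polynomial ℤ)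
    (hK : IntermediateField.adjoin ℚ {α} = ⊤)
    (hA : RationalTile.IsPrimitiveMinpoly A α)
    (hexp : RationalTile.IsExpanding A)
    (𝔞 𝔟 : Ideal (NumberField.RingOfIntegers K))
    (hcop : 𝔞 ⊔ 𝔟 = ⊤)
    (hα : FractionalIdeal.spanSingleton (nonZeroDivisors (NumberField.RingOfIntegers K)) α *
        (𝔟 : FractionalIdeal (nonZeroDivisors (NumberField.RingOfIntegers K)) K) =
      (𝔞 : FractionalIdeal (nonZeroDivisors (NumberField.RingOfIntegers K)) K)) :
    -- the elements `w₀, …, w_{n-1}` form a `ℤ`-basis of `Λ_{α,0}`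
    (LinearIndependent ℤ (fun i : Fin A.natDegree => RationalTile.w A α i) ∧
      (Submodule.span ℤ (Set.range fun i : Fin A.natDegree => RationalTile.w A α i) : Set K) =
        RationalTile.Lam α 0) ∧
    -- the tile `F` and all SRS tiles exist and are unique
    (∃! F : Set (RationalTile.RepSpace K 𝔟),
      RationalTile.IsSelfAffineTile α 𝔟 (RationalTile.digitSet A K) F) ∧
    (∀ z : Fin A.natDegree → ℤ, ∃! T : Set (Fin A.natDegree → ℝ),
      RationalTile.IsSRSTile (RationalTile.param A) z T) ∧
    -- `Υ` is the linear map which equals `Φ_∞ ∘ ι_α` on `ℚⁿ`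
    ∃ Υ : (Fin A.natDegree → ℝ) →ₗ[ℝ] NumberField.mixedEmbedding.mixedSpace K,
      (∀ q : Fin A.natDegree → ℚ,
        Υ (fun i => (q i : ℝ)) = NumberField.mixedEmbedding K (RationalTile.iota A α q)) ∧
      ∀ F : Set (RationalTile.RepSpace K 𝔟),
        RationalTile.IsSelfAffineTile α 𝔟 (RationalTile.digitSet A K) F →
        (∀ (z : Fin A.natDegree → ℤ) (T : Set (Fin A.natDegree → ℝ)),
          RationalTile.IsSRSTile (RationalTile.param A) z T →
          RationalTile.intersectiveTile F (RationalTile.iota A α fun i => (z i : ℚ)) = Υ '' T) ∧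
        -- the two collections of tiles correspond under `Υ`
        {X | ∃ x ∈ RationalTile.Lam α 0, X = RationalTile.intersectiveTile F x} =
          {X | ∃ (z : Fin A.natDegree → ℤ) (T : Set (Fin A.natDegree → ℝ)),
            RationalTile.IsSRSTile (RationalTile.param A) z T ∧ X = Υ '' T} := by
  have h : RationalTile.IsExpandingGenerator α A := ⟨hK, hA, hexp⟩
  have h𝔟 : RationalTile.IsPoleIdeal α 𝔟 := RationalTile.isPoleIdeal_of_spanSingleton_mul hcop hα
  have hmem {x : K} : x ∈ RationalTile.Lam α 0 ↔ ∃ z, RationalTile.latticePoint A α z = x := by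
    rw [← RationalTile.coe_lamZero h.ne_zero]
    exact hA.mem_lamZero_iff_exists_latticePoint h.coeff_zero_ne_zero
  have hF := h𝔟.existsUnique_isSelfAffineTile
    (hexp.one_lt_infinitePlace h.aeval_eq_zero) h.ne_zero h.coeff_zero_ne_zero
  have hT := h.isSRSTile_upsilon_preimage h𝔟 hF.choose_spec.1
  refine ⟨⟨h.linearIndependent_w, ?_⟩, hF, fun z => ⟨_, hT z, fun T hz => hz.unique (hT z)⟩,
    RationalTile.upsilon A α, RationalTile.upsilon_ratCast,
    fun F hF => ⟨fun z T => h.intersectiveTile_eq_upsilon_image h𝔟 hF, Set.ext fun X => ⟨?_, ?_⟩⟩⟩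
  · rw [hA.span_w_eq_lamZero h.ne_zero, RationalTile.coe_lamZero h.ne_zero]
  · rintro ⟨x, hx, rfl⟩
    obtain ⟨z, rfl⟩ := hmem.1 hx
    exact ⟨z, _, hT z, h.intersectiveTile_eq_upsilon_image h𝔟 hF (hT z)⟩
  · rintro ⟨z, T, hz, rfl⟩
    exact ⟨_, hmem.2 ⟨z, rfl⟩, (h.intersectiveTile_eq_upsilon_image h𝔟 hF hz).symm⟩
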